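/- Let $\mathcal H$ be a finite simple hypergraph: a finite vertex set $V=\{x_1,\dots,x_n\}$ together with a set of edges, which are subsets of $V$ with at least two elements, none of which is contained in another. Let $k$ be a field and $R=k[x_1,\dots,x_n]$. A vertex cover of $\mathcal H$ is a subset $W\subseteq V$ that meets every edge, and the cover ideal of $\mathcal H$ is $$J=J(\mathcal H)=\Bigl(\,\prod_{x\in W}x \;\Big|\; W \text{ is a vertex cover of } \mathcal H\Bigr)\subseteq R.$$ The chromatic number $\chi(\mathcal H)$ is the least $d$ such that $V$ is the union of $d$ pairwise disjoint sets none of which contains an edge. For an $R$-module $M$ let $\operatorname{Ass}(M)$ be its set of associated primes. If $a$ is the least non-negative integer such that $$\bigcup_{s=1}^{\infty}\operatorname{Ass}(R/J^s)=\bigcup_{s=1}^{a}\operatorname{Ass}(R/J^s),$$ then $a\ge\chi(\mathcal H)-1$. -/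

import Mathlib

namespace Hypergraph

/-- A finite simple hypergraph: finitely many vertices, every edge has at least two vertices, and
no edge is contained in another one. -/
structure IsFiniteSimple {α : Type*} (H : Hypergraph α) : Prop where
  finite_vertexSet : H.vertexSet.Finite
  two_le_ncard : ∀ e ∈ H.edgeSet, 2 ≤ e.ncard
  antichain : IsAntichain (· ⊆ ·) H.edgeSet

/-- A vertex cover: a set of vertices that meets every edge. -/
def IsVertexCover {α : Type*} (H : Hypergraph α) (W : Finset H.vertexSet) : Prop :=
  ∀ e ∈ H.edgeSet, ∃ x ∈ W, (x : α) ∈ e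

/-- The cover ideal in the polynomial ring over `k` whose variables are the vertices: it is
generated by the monomials `∏ x ∈ W, x` where `W` is a vertex cover. -/
noncomputable def coverIdeal {α : Type*} (H : Hypergraph α) (k : Type*) [Field k] :
    Ideal (MvPolynomial H.vertexSet k) :=
  Ideal.span {m | ∃ W : Finset H.vertexSet, H.IsVertexCover W ∧ m = ∏ x ∈ W, MvPolynomial.X x}

/-- A `d`-coloring: the vertex set is the union of `d` pairwise disjoint color classes, none of
which contains an edge. -/
structure IsColoring {α : Type*} (H : Hypergraph α) {d : ℕ} (C : Fin d → Set α) : Prop where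
  disjoint : ∀ i j, i ≠ j → Disjoint (C i) (C j)
  iUnion_eq : ⋃ i, C i = H.vertexSet
  not_subset : ∀ e ∈ H.edgeSet, ∀ i, ¬ e ⊆ C i

/-- The chromatic number: the least `d` such that there is a `d`-coloring. -/
noncomputable def chromaticNumber {α : Type*} (H : Hypergraph α) : ℕ :=
  sInf {d | ∃ C : Fin d → Set α, H.IsColoring C}

/-- For a finite simple hypergraph the infimum that defines the chromatic number is attained. -/
theorem IsFiniteSimple.isLeast_chromaticNumber {α : Type*} {H : Hypergraph α}
    (hH : H.IsFiniteSimple) :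
    IsLeast {d | ∃ C : Fin d → Set α, H.IsColoring C} H.chromaticNumber := by
  have hne : {d | ∃ C : Fin d → Set α, H.IsColoring C}.Nonempty := by
    have := hH.finite_vertexSet.to_subtype
    obtain ⟨n, ⟨f⟩⟩ := Finite.exists_equiv_fin H.vertexSet
    refine ⟨n, fun i => {((f.symm i : H.vertexSet) : α)}, ?_, ?_, ?_⟩
    · intro i j hij
      rw [Set.disjoint_singleton]
      exact fun h => hij (f.symm.injective (Subtype.ext h))
    · ext x
      simp only [Set.mem_iUnion, Set.mem_singleton_iff]
      constructor
      · rintro ⟨i, rfl⟩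
        exact (f.symm i).2
      · intro hx
        exact ⟨f ⟨x, hx⟩, by simp⟩
    · intro e he i hsub
      have h1 := Set.ncard_le_ncard hsub (Set.finite_singleton _)
      have h2 := hH.two_le_ncard e he
      rw [Set.ncard_singleton] at h1
      omega
  exact ⟨Nat.sInf_mem hne, fun d hd => Nat.sInf_le hd⟩

end Hypergraph

namespace Hypergraph

open MvPolynomial

variable {α : Type*} {H : Hypergraph α}

/-! A set contains no edge exactly when its complement is a vertex cover, so colorings can be read
off exponents: a product of `n` cover monomials has exponent below `n` at `x` iff some factor misses
`x`. Suppose `a < n` with `n = χ - 1`. The vertex set is not `n`-part-colorable; take a minimal such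
`U`. The prime generated by the variables of `U` is associated to `R/J^n`
(`span_X_image_mem_associatedPrimes`), hence to `R/J^s` for some `s ≤ a`. But then `U` is
`(s+1)`-part-colorable (`isPartColorable_succ_of_mem_associatedPrimes`), and `s + 1 ≤ n` gives a
contradiction. -/

/-- The exponent vector of the squarefree monomial with support `W`. -/
noncomputable def indicatorExponent {σ : Type*} (W : Finset σ) : σ →₀ ℕ :=
  ∑ x ∈ W, Finsupp.single x 1

open Classical in
theorem indicatorExponent_apply {σ : Type*} (W : Finset σ) (x : σ) :
    indicatorExponent W x = if x ∈ W then 1 else 0 := by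
  simp [indicatorExponent, Finsupp.finsetSum_apply, Finsupp.single_apply]

theorem indicatorExponent_le_one {σ : Type*} (W : Finset σ) (x : σ) :
    indicatorExponent W x ≤ 1 := by
  classical
  rw [indicatorExponent_apply]
  split_ifs <;> simp

/-- The exponent vectors of products of `n` squarefree monomials of vertex covers. -/
def coverExponents (H : Hypergraph α) (n : ℕ) : Set (H.vertexSet →₀ ℕ) :=
  {a | ∃ W : Fin n → Finset H.vertexSet,
    (∀ j, H.IsVertexCover (W j)) ∧ a = ∑ j, indicatorExponent (W j)}

/-- `U` is the union of `n` sets, each contained in the complement of a vertex cover. -/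
def IsPartColorable (H : Hypergraph α) (n : ℕ) (U : Finset H.vertexSet) : Prop :=
  ∃ W : Fin n → Finset H.vertexSet,
    (∀ j, H.IsVertexCover (W j)) ∧ ∀ x ∈ U, ∃ j, x ∉ W j

theorem IsPartColorable.mono {m n : ℕ} {U : Finset H.vertexSet}
    (h : H.IsPartColorable (m + 1) U) (hmn : m + 1 ≤ n) : H.IsPartColorable n U := by
  obtain ⟨W, hW, hU⟩ := h
  -- Covers are repeated cyclically, so at least one must be given, hence `m + 1`.
  refine ⟨fun j => W (Fin.ofNat (m + 1) j), fun j => hW _, fun x hx => ?_⟩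
  obtain ⟨j, hj⟩ := hU x hx
  exact ⟨Fin.castLE hmn j, by simpa using hj⟩

theorem coverIdeal_pow (H : Hypergraph α) (k : Type*) [Field k] (n : ℕ) :
    H.coverIdeal k ^ n =
      Ideal.span ((fun s => monomial s (1 : k)) '' H.coverExponents n) := by
  induction n with
  | zero =>
    symm
    rw [pow_zero, Ideal.one_eq_top, Ideal.eq_top_iff_one]
    apply Ideal.subset_span
    exact ⟨0, ⟨Fin.elim0, fun j => j.elim0, by simp⟩, rfl⟩
  | succ n ih =>
    rw [pow_succ, ih, coverIdeal, Ideal.span_mul_span']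
    congr 1
    ext p
    have hX (W : Finset H.vertexSet) :
        ∏ x ∈ W, (X x : MvPolynomial H.vertexSet k) = monomial (indicatorExponent W) 1 := by
      rw [indicatorExponent, monomial_sum_one]
      rfl
    constructor
    · rintro ⟨_, ⟨_, ⟨W, hW, rfl⟩, rfl⟩, _, ⟨W', hW', rfl⟩, rfl⟩
      refine ⟨indicatorExponent W' + ∑ j, indicatorExponent (W j),
        ⟨Fin.cons W' W, fun j => Fin.cases hW' hW j, by simp [Fin.sum_univ_succ]⟩, ?_⟩
      simp [hX, monomial_mul, add_comm]
    · rintro ⟨_, ⟨W, hW, rfl⟩, rfl⟩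
      refine ⟨_, ⟨∑ j : Fin n, indicatorExponent (W j.succ),
        ⟨fun j => W j.succ, fun j => hW _, rfl⟩, rfl⟩, _, ⟨W 0, hW 0, rfl⟩, ?_⟩
      simp [hX, monomial_mul, add_comm, Fin.sum_univ_succ]

theorem mem_coverIdeal_pow {k : Type*} [Field k] {n : ℕ} {p : MvPolynomial H.vertexSet k} :
    p ∈ H.coverIdeal k ^ n ↔ ∀ m ∈ p.support, ∃ t ∈ H.coverExponents n, t ≤ m := by
  rw [coverIdeal_pow, mem_ideal_span_monomial_image]

theorem IsFiniteSimple.exists_mem_ne (hH : H.IsFiniteSimple) {e : Set α} (he : e ∈ H.edgeSet)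
    (x : α) : ∃ y ∈ e, y ≠ x :=
  Set.exists_ne_of_one_lt_ncard (hH.two_le_ncard e he) x

theorem IsFiniteSimple.isVertexCover_compl_singleton [Fintype H.vertexSet]
    [DecidableEq H.vertexSet] (hH : H.IsFiniteSimple) (x : H.vertexSet) :
    H.IsVertexCover {x}ᶜ := by
  intro e he
  obtain ⟨y, hy, hyx⟩ := hH.exists_mem_ne he x
  exact ⟨⟨y, mem_vertexSet_of_mem_edgeSet he hy⟩, by simpa [Subtype.ext_iff] using hyx, hy⟩

theorem IsFiniteSimple.isPartColorable_empty [Fintype H.vertexSet] (hH : H.IsFiniteSimple)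
    (n : ℕ) : H.IsPartColorable n ∅ := by
  refine ⟨fun _ => Finset.univ, fun _ e he => ?_, by simp⟩
  obtain ⟨y, hy⟩ := Set.nonempty_of_ncard_ne_zero (s := e)
    (by have := hH.two_le_ncard e he; omega)
  exact ⟨⟨y, mem_vertexSet_of_mem_edgeSet he hy⟩, by simp, hy⟩

/-- Color each vertex by the index of one cover that misses it; a class then avoids its cover, so it
contains no edge. -/
theorem IsFiniteSimple.chromaticNumber_le [Fintype H.vertexSet] (hH : H.IsFiniteSimple) {n : ℕ}
    (h : H.IsPartColorable n Finset.univ) : H.chromaticNumber ≤ n := by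
  obtain ⟨W, hW, hU⟩ := h
  choose f hf using fun x => hU x (Finset.mem_univ x)
  refine hH.isLeast_chromaticNumber.2 ⟨fun j => {y | ∃ h : y ∈ H.vertexSet, f ⟨y, h⟩ = j},
    ?_, ?_, ?_⟩
  · intro i j hij
    rw [Set.disjoint_left]
    rintro y ⟨h, rfl⟩ ⟨_, h'⟩
    exact hij h'
  · ext y
    simp
  · intro e he j hsub
    obtain ⟨x, hx, hxe⟩ := hW j e he
    obtain ⟨_, rfl⟩ := hsub hxe
    exact hf x hx

theorem sum_indicatorExponent_le {σ : Type*} {n : ℕ} (W : Fin n → Finset σ) (x : σ) :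
    (∑ j, indicatorExponent (W j)) x ≤ n := by
  rw [Finsupp.finsetSum_apply]
  exact (Finset.sum_le_card_nsmul _ _ 1 fun j _ => indicatorExponent_le_one _ _).trans (by simp)

theorem exists_notMem_iff_sum_indicatorExponent_lt {σ : Type*} {n : ℕ} (W : Fin n → Finset σ)
    (x : σ) : (∃ j, x ∉ W j) ↔ (∑ j, indicatorExponent (W j)) x < n := by
  classical
  rw [Finsupp.finsetSum_apply]
  constructor
  · rintro ⟨j, hj⟩
    have : ∑ j, indicatorExponent (W j) x < ∑ _j : Fin n, 1 :=
      Finset.sum_lt_sum (fun j _ => indicatorExponent_le_one _ _)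
        ⟨j, Finset.mem_univ j, by simp [indicatorExponent_apply, hj]⟩
    simpa using this
  · intro h
    by_contra! hc
    simp [indicatorExponent_apply, hc] at h

/-- The `n` covers dividing `a + single i 1` handle every vertex of `U` except possibly `i`; the
extra cover `{i}ᶜ` handles `i`. -/
theorem IsFiniteSimple.isPartColorable_succ [Fintype H.vertexSet] (hH : H.IsFiniteSimple) {n : ℕ}
    {U : Finset H.vertexSet} {a : H.vertexSet →₀ ℕ}
    (ha : ¬ ∃ t ∈ H.coverExponents n, t ≤ a)
    (hU : ∀ x ∈ U, ∃ t ∈ H.coverExponents n, t ≤ a + Finsupp.single x 1) :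
    H.IsPartColorable (n + 1) U := by
  classical
  -- Exponents in `coverExponents n` never exceed `n`, so if `n ≤ a x`, raising the exponent at `x`
  -- could not help.
  have hlt : ∀ x ∈ U, a x < n := by
    intro x hx
    by_contra! hle
    obtain ⟨_, ⟨W, hW, rfl⟩, ht⟩ := hU x hx
    refine ha ⟨_, ⟨W, hW, rfl⟩, fun y => ?_⟩
    by_cases hxy : y = x
    · subst hxy
      exact (sum_indicatorExponent_le W y).trans hle
    · simpa [Finsupp.single_apply, Ne.symm hxy] using ht y
  obtain rfl | ⟨i, hi⟩ := U.eq_empty_or_nonempty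
  · exact hH.isPartColorable_empty _
  obtain ⟨_, ⟨W, hW, rfl⟩, ht⟩ := hU i hi
  refine ⟨Fin.cons {i}ᶜ W, fun j => Fin.cases (hH.isVertexCover_compl_singleton i) hW j,
    fun x hx => ?_⟩
  by_cases hxi : x = i
  · exact ⟨0, by simp [hxi]⟩
  · have hle : (∑ j, indicatorExponent (W j)) x ≤ a x := by
      simpa [Finsupp.single_apply, Ne.symm hxi] using ht x
    obtain ⟨j, hj⟩ :=
      (exists_notMem_iff_sum_indicatorExponent_lt W x).2 (hle.trans_lt (hlt x hx))
    exact ⟨j.succ, by simpa using hj⟩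

open Classical in
/-- The exponent vector with entry `n - 1` at the vertices of `U` and `n` elsewhere. -/
noncomputable def criticalExponent [Finite H.vertexSet] (n : ℕ) (U : Finset H.vertexSet) :
    H.vertexSet →₀ ℕ :=
  Finsupp.equivFunOnFinite.symm fun x => if x ∈ U then n - 1 else n

theorem isPartColorable_of_le_add_criticalExponent [Finite H.vertexSet] {n : ℕ} (hn : 1 ≤ n)
    {U : Finset H.vertexSet} {a : H.vertexSet →₀ ℕ} (ha : ∀ x ∈ U, a x = 0)
    (h : ∃ t ∈ H.coverExponents n, t ≤ a + criticalExponent n U) :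
    H.IsPartColorable n U := by
  obtain ⟨_, ⟨W, hW, rfl⟩, ht⟩ := h
  refine ⟨W, hW, fun x hx => (exists_notMem_iff_sum_indicatorExponent_lt W x).2 ?_⟩
  have := ht x
  simp only [criticalExponent, Finsupp.add_apply, ha x hx, zero_add,
    Finsupp.equivFunOnFinite_symm_apply_apply, hx, if_true] at this
  omega

open Classical in
theorem exists_le_criticalExponent_add_single [Finite H.vertexSet] {n : ℕ}
    {U : Finset H.vertexSet} {i : H.vertexSet} (h : H.IsPartColorable n (U.erase i)) :
    ∃ t ∈ H.coverExponents n, t ≤ criticalExponent n U + Finsupp.single i 1 := by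
  obtain ⟨W, hW, hU⟩ := h
  refine ⟨_, ⟨W, hW, rfl⟩, fun x => ?_⟩
  have hle := sum_indicatorExponent_le W x
  simp only [criticalExponent, Finsupp.add_apply, Finsupp.equivFunOnFinite_symm_apply_apply,
    Finsupp.single_apply]
  by_cases hxi : i = x
  · split_ifs <;> omega
  · by_cases hx : x ∈ U
    · have := (exists_notMem_iff_sum_indicatorExponent_lt W x).1
        (hU x (Finset.mem_erase.2 ⟨Ne.symm hxi, hx⟩))
      simp only [hx, if_true]
      omega
    · simp only [hx, if_false]
      omega

/-- The ideal is the kernel of the substitution sending the variables in `s` to zero, whose target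
is a domain. -/
theorem isPrime_span_X_image {σ k : Type*} [Field k] (s : Set σ) :
    (Ideal.span (X '' s : Set (MvPolynomial σ k))).IsPrime := by
  classical
  let φ : MvPolynomial σ k →ₐ[k] MvPolynomial σ k := aeval fun i => if i ∈ s then 0 else X i
  have hker : Ideal.span (X '' s : Set (MvPolynomial σ k)) = RingHom.ker φ := by
    apply le_antisymm
    · rw [Ideal.span_le]
      rintro _ ⟨i, hi, rfl⟩
      simp [φ, hi]
    · intro p hp
      have hcomp : (Ideal.Quotient.mkₐ k (Ideal.span (X '' s : Set (MvPolynomial σ k)))).comp φ =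
          Ideal.Quotient.mkₐ k _ := by
        ext i
        by_cases hi : i ∈ s
        · simpa [φ, hi] using
            (Ideal.Quotient.eq_zero_iff_mem.2
              (Ideal.subset_span (Set.mem_image_of_mem X hi))).symm
        · simp [φ, hi]
      have := DFunLike.congr_fun hcomp p
      rw [AlgHom.comp_apply, (RingHom.mem_ker).1 hp, map_zero] at this
      exact Ideal.Quotient.eq_zero_iff_mem.1 this.symm
  rw [hker]
  exact RingHom.ker_isPrime _

theorem mem_associatedPrimes_quotient_iff {R : Type*} [CommRing R] [IsNoetherianRing R]
    {I P : Ideal R} :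
    P ∈ associatedPrimes R (R ⧸ I) ↔ P.IsPrime ∧ ∃ f : R, ∀ r, r ∈ P ↔ r * f ∈ I := by
  have h (f r : R) : r ∈ (⊥ : Submodule R (R ⧸ I)).colon {Ideal.Quotient.mk I f} ↔ r * f ∈ I := by
    rw [Submodule.mem_colon_singleton, Submodule.mem_bot, ← Ideal.Quotient.eq_zero_iff_mem]
    rfl
  rw [AssociatedPrimes.mem_iff, isAssociatedPrime_iff]
  refine and_congr_right fun _ => ⟨?_, ?_⟩
  · rintro ⟨x, rfl⟩
    obtain ⟨f, rfl⟩ := Ideal.Quotient.mk_surjective x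
    exact ⟨f, h f⟩
  · rintro ⟨f, hf⟩
    exact ⟨Ideal.Quotient.mk I f, Ideal.ext fun r => (hf r).trans (h f r).symm⟩

theorem IsFiniteSimple.isPartColorable_succ_of_mem_associatedPrimes [Fintype H.vertexSet]
    (hH : H.IsFiniteSimple) {k : Type*} [Field k] {n : ℕ} {U : Finset H.vertexSet}
    (h : Ideal.span (X '' (U : Set H.vertexSet)) ∈ associatedPrimes (MvPolynomial H.vertexSet k)
      (MvPolynomial H.vertexSet k ⧸ H.coverIdeal k ^ n)) :
    H.IsPartColorable (n + 1) U := by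
  obtain ⟨hP, f, hf⟩ := mem_associatedPrimes_quotient_iff.1 h
  have h1 : f ∉ H.coverIdeal k ^ n := by
    intro hmem
    exact (Ideal.ne_top_iff_one _).1 hP.ne_top ((hf 1).2 (by simpa using hmem))
  rw [mem_coverIdeal_pow] at h1
  push Not at h1
  obtain ⟨a, ha, hna⟩ := h1
  refine hH.isPartColorable_succ (a := a) (by push Not; exact hna) fun x hx => ?_
  have hx' := mem_coverIdeal_pow.1 ((hf (X x)).1 (Ideal.subset_span ⟨x, hx, rfl⟩))
  refine hx' _ ?_
  rw [mul_comm, mem_support_iff, coeff_mul_X]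
  exact mem_support_iff.1 ha

theorem span_X_image_mem_associatedPrimes [Finite H.vertexSet] {k : Type*} [Field k]
    {n : ℕ} (hn : 1 ≤ n) {U : Finset H.vertexSet}
    (hU : Minimal (fun U => ¬ H.IsPartColorable n U) U) :
    Ideal.span (X '' (U : Set H.vertexSet)) ∈ associatedPrimes (MvPolynomial H.vertexSet k)
      (MvPolynomial H.vertexSet k ⧸ H.coverIdeal k ^ n) := by
  classical
  refine mem_associatedPrimes_quotient_iff.2
    ⟨isPrime_span_X_image _, monomial (criticalExponent n U) 1, fun p => ⟨fun hp => ?_, ?_⟩⟩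
  -- By minimality `U.erase i` is colorable, so each `X i` with `i ∈ U` lies in the colon ideal.
  · suffices Ideal.span (X '' (U : Set H.vertexSet)) ≤
        (H.coverIdeal k ^ n).colon {monomial (criticalExponent n U) (1 : k)} from
      Submodule.mem_colon_singleton.1 (this hp)
    rw [Ideal.span_le]
    rintro _ ⟨i, hi, rfl⟩
    have herase : H.IsPartColorable n (U.erase i) := by
      by_contra hc
      exact hU.not_lt hc (Finset.erase_ssubset hi)
    rw [SetLike.mem_coe, Submodule.mem_colon_singleton, smul_eq_mul, mul_comm, X,
      monomial_mul, one_mul, mem_coverIdeal_pow]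
    intro m hm
    rw [Finset.mem_singleton.1 (support_monomial_subset hm)]
    exact exists_le_criticalExponent_add_single herase
  · intro hp
    rw [mem_ideal_span_X_image]
    intro a ha
    -- A monomial of `p` free of the variables of `U` would yield a coloring of `U`.
    by_contra! hc
    refine hU.1 (isPartColorable_of_le_add_criticalExponent hn hc
      (mem_coverIdeal_pow.1 hp _ ?_))
    rw [mem_support_iff, coeff_mul_monomial, mul_one]
    exact mem_support_iff.1 ha

end Hypergraph

theorem mainTheorem10 {α : Type*} (H : Hypergraph α) (hH : H.IsFiniteSimple)
    (k : Type*) [Field k] (a : ℕ)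
    (ha : IsLeast {b : ℕ |
      (⋃ s ∈ Set.Ici (1 : ℕ),
          associatedPrimes (MvPolynomial H.vertexSet k)
            (MvPolynomial H.vertexSet k ⧸ H.coverIdeal k ^ s)) =
        (⋃ s ∈ Set.Icc 1 b,
          associatedPrimes (MvPolynomial H.vertexSet k)
            (MvPolynomial H.vertexSet k ⧸ H.coverIdeal k ^ s))} a) :
    (H.chromaticNumber : ℤ) - 1 ≤ (a : ℤ) := by
  classical
  have := hH.finite_vertexSet.to_subtype
  have := Fintype.ofFinite H.vertexSet
  by_contra! hlt
  -- The subtraction does not truncate: `hlt` gives `χ - 1 > a ≥ 0`.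
  set n := H.chromaticNumber - 1 with hn
  have hnot : ¬ H.IsPartColorable n Finset.univ := fun h => by
    have := hH.chromaticNumber_le h
    omega
  have hn1 : 1 ≤ n := by omega
  obtain ⟨U, hU⟩ := exists_minimal_of_wellFoundedLT (fun U => ¬ H.IsPartColorable n U) ⟨_, hnot⟩
  obtain ⟨s, hs, hsU⟩ := Set.mem_iUnion₂.1 (ha.1.subset (Set.mem_iUnion₂.2
    ⟨n, hn1, Hypergraph.span_X_image_mem_associatedPrimes (k := k) hn1 hU⟩))
  refine hU.1 ((hH.isPartColorable_succ_of_mem_associatedPrimes hsU).mono ?_)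
  have := hs.2
  omega
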